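/- Let $S \in \mathbb{N}$, let $v \in [0,1]^S$ be fixed, and let $\alpha \in \mathbb{R}^S$ have $\alpha_i \ge 0$ for all $i$ and $\sum_{i=1}^S \alpha_i \ge 2$. Let $P \sim \mathrm{Dirichlet}(\alpha)$, that is, $P$ is distributed as $\left(\gamma_1/\sum_j \gamma_j, \dots, \gamma_S/\sum_j \gamma_j\right)$ with $\gamma_1,\dots,\gamma_S$ independent and $\gamma_i \sim \mathrm{Gamma}(\alpha_i,1)$, where $\gamma_i = 0$ almost surely if $\alpha_i = 0$. Let $X = P^{\top} v = \sum_{i=1}^S P_i v_i$, and let $Y \sim N(\mu,\sigma^2)$ be a random variable on the same probability space (with arbitrary dependence on $P$), where $$\mu = \frac{\sum_{i=1}^S \alpha_i v_i}{\sum_{i=1}^S \alpha_i}, \qquad \sigma^2 = \Big(\sum_{i=1}^S \alpha_i\Big)^{-1}.$$ Then $X$ and $Y$ are integrable, $\mathbb{E}[X] = \mathbb{E}[Y]$, and $X$ second-order stochastically dominates $Y$: for every concave non-decreasing function $u : \mathbb{R} \to \mathbb{R}$, $$\mathbb{E}[u(X)] \ge \mathbb{E}[u(Y)],$$ where both expectations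 are taken in $[-\infty, \infty)$ (the positive parts of $u(X)$ and $u(Y)$ are integrable; $\mathbb{E}[u(Y)]$ may equal $-\infty$). -/

import Mathlib

open MeasureTheory ProbabilityTheory
open scoped ENNReal Matrix

/-- The Gamma distribution with shape `a ≥ 0` and rate `1`; for shape `0` it is the point mass
at `0` (the weak limit of the Gamma distributions as the shape tends to `0`). -/
noncomputable def gammaLaw (a : ℝ) : Measure ℝ :=
  if a = 0 then Measure.dirac 0 else gammaMeasure a 1

/-- The Dirichlet distribution on `ℝ^S` with parameters `α i ≥ 0`, not all zero, by Ferguson's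
definition: the law of `(γ₁ / ∑ γⱼ, …, γ_S / ∑ γⱼ)`, where the `γᵢ` are independent and `γᵢ` has
the Gamma distribution with shape `α i` and rate `1`. A coordinate with `α i = 0` is almost
surely `0`. -/
noncomputable def dirichletMeasure {S : ℕ} (α : Fin S → ℝ) : Measure (Fin S → ℝ) :=
  (Measure.pi fun i => gammaLaw (α i)).map fun g i => g i / ∑ j, g j

/-- The expectation `E[Z⁺] - E[Z⁻]` of a real random variable `Z`, with values in `[-∞, ∞]`.
It is meaningful as soon as `E[Z⁺]` or `E[Z⁻]` is finite. -/
noncomputable def extendedExpectation {Ω : Type*} [MeasurableSpace Ω] (μ : Measure Ω)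
    (Z : Ω → ℝ) : EReal :=
  ((∫⁻ ω, ENNReal.ofReal (Z ω) ∂μ : ℝ≥0∞) : EReal) -
    ((∫⁻ ω, ENNReal.ofReal (-Z ω) ∂μ : ℝ≥0∞) : EReal)

/-- `X` second-order stochastically dominates `Y`: `E[u(X)] ≥ E[u(Y)]` for all concave
non-decreasing `u : ℝ → ℝ`. As such a `u` lies below an affine function, `E[u(X)⁺]` and
`E[u(Y)⁺]` are finite when `X` and `Y` are integrable, so both expectations exist in `[-∞, ∞)`. The
value `-∞` does occur, for instance for Gaussian `Y` and `u` decaying fast enough at `-∞`. -/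
def SecondOrderDominates {Ω : Type*} [MeasurableSpace Ω] (μ : Measure Ω) (X Y : Ω → ℝ) : Prop :=
  ∀ u : ℝ → ℝ, ConcaveOn ℝ Set.univ u → Monotone u →
    extendedExpectation μ (fun ω => u (Y ω)) ≤ extendedExpectation μ (fun ω => u (X ω))

/-!
The proof compares Stein kernels. Write `n = ∑ αᵢ`, `m = ∑ αᵢ vᵢ / n`, and let `X` be the average
of the `vᵢ` with the random weights `γᵢ / ∑ γⱼ`.

Integration by parts for the Gamma density, `E[(γ - a) F(γ)] = E[γ F'(γ)]`, used in each coordinate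
`γᵢ` with `F = (vᵢ - X) g(X)` and summed over `i`, gives

  `n E[(X - m) g(X)] = E[V g'(X)]`,

where `V` is the variance of `v` under the weights `γᵢ / ∑ γⱼ`
(`dirichlet_stein_identity`). So `V / n` is a Stein kernel of `X`, and `V ≤ 1` because `v` takes
values in `[0, 1]`, whereas the Stein kernel of `N(m, 1/n)` is the constant `1 / n`.

For `f` convex let `c` be its mean under `N(m, 1/n)`. The Gaussian Stein equation
`g'(x) / n - (x - m) g(x) = f(x) - c` has a solution `g` that is nonincreasing
(`exists_gaussian_stein_solution`): at a given `x` the sign of `g'(x)` is unaffected by subtracting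
from `f` its supporting line at `x`, so one may assume `f ≥ 0 = f(x)`, and then `g'(x)` is minus a
combination of `∫_{y ≤ x} f` and `∫_{y > x} f` with the nonnegative coefficients `E (Y - x)⁺` and
`E (x - Y)⁺`. Hence

  `E f(X) - c = E[g'(X) / n - (X - m) g(X)] = E[(1 - V) g'(X)] / n ≤ 0`,

which is applied to `f = -u`. The argument works for every `n > 0`. If `u(Y)` is not integrable,
then its expectation is `-∞`, as a concave function lies below an affine one.
-/

open Filter Topology NNReal

/-! ### Convex functions on the line -/

lemma ConvexOn.exists_subgradient {f : ℝ → ℝ} (hf : ConvexOn ℝ Set.univ f) (x : ℝ) :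
    ∃ k, ∀ y, f x + k * (y - x) ≤ f y := by
  have hx : x ∈ interior (Set.univ : Set ℝ) := by simp
  refine ⟨derivWithin f (Set.Ioi x) x, fun y => ?_⟩
  rcases lt_trichotomy x y with h | rfl | h
  · have := hf.rightDeriv_le_slope_of_mem_interior hx (Set.mem_univ y) h
    rw [slope_def_field, le_div_iff₀ (by linarith)] at this
    linarith
  · simp
  · have h1 := hf.slope_le_leftDeriv_of_mem_interior (Set.mem_univ y) hx h
    have h2 := h1.trans (hf.leftDeriv_le_rightDeriv_of_mem_interior hx)
    rw [slope_def_field, div_le_iff₀ (by linarith)] at h2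
    linarith

lemma ConvexOn.continuous_of_univ {f : ℝ → ℝ} (hf : ConvexOn ℝ Set.univ f) : Continuous f :=
  continuousOn_univ.1 (hf.continuousOn isOpen_univ)

/-! ### The Stein equation of the Gaussian distribution -/

lemma continuous_gaussianPDFReal (m : ℝ) (s : ℝ≥0) : Continuous (gaussianPDFReal m s) := by
  unfold gaussianPDFReal; fun_prop

lemma hasDerivAt_gaussianPDFReal (m : ℝ) {s : ℝ≥0} (hs : s ≠ 0) (x : ℝ) :
    HasDerivAt (gaussianPDFReal m s) (-((x - m) / s) * gaussianPDFReal m s x) x := by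
  have hs' : (s : ℝ) ≠ 0 := by exact_mod_cast hs
  unfold gaussianPDFReal
  have h := ((((((hasDerivAt_id x).sub_const m).pow 2).neg).div_const (2 * (s : ℝ))).exp).const_mul
    ((√(2 * Real.pi * s))⁻¹)
  refine h.congr_deriv ?_
  simp only [Pi.pow_apply, Pi.neg_apply, id_eq]
  field_simp
  ring_nf

lemma integrable_gaussianReal_iff {m : ℝ} {s : ℝ≥0} (hs : s ≠ 0) {h : ℝ → ℝ} :
    Integrable h (gaussianReal m s) ↔ Integrable fun x => gaussianPDFReal m s x * h x := by
  rw [gaussianReal_of_var_ne_zero _ hs, integrable_withDensity_iff_integrable_smul'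
    (measurable_gaussianPDF m s) (ae_of_all _ fun _ => gaussianPDF_lt_top)]
  simp [toReal_gaussianPDF]

lemma setIntegral_gaussianReal {m : ℝ} {s : ℝ≥0} (hs : s ≠ 0) (h : ℝ → ℝ) {t : Set ℝ}
    (ht : MeasurableSet t) :
    ∫ x in t, h x ∂gaussianReal m s = ∫ x in t, gaussianPDFReal m s x * h x := by
  rw [gaussianReal_of_var_ne_zero _ hs, setIntegral_withDensity_eq_setIntegral_toReal_smul
    (measurable_gaussianPDF m s) (ae_of_all _ fun _ => gaussianPDF_lt_top) _ ht]
  simp [toReal_gaussianPDF]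

lemma integrable_fun_id_gaussianReal (m : ℝ) (s : ℝ≥0) :
    Integrable (fun x : ℝ => x) (gaussianReal m s) :=
  (memLp_id_gaussianReal (μ := m) (v := s) 1).integrable (by simp)

/-- The Gaussian Stein kernel is constant: `y ↦ -s p(y)` is an antiderivative of `(y - m) p(y)`,
for `p` the density of `N(m, s)`. -/
lemma setIntegral_Iic_gaussianReal_sub {m : ℝ} {s : ℝ≥0} (hs : s ≠ 0) (x : ℝ) :
    ∫ y in Set.Iic x, (y - m) ∂gaussianReal m s = -(s * gaussianPDFReal m s x) := by
  have hs' : (s : ℝ) ≠ 0 := by exact_mod_cast hs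
  rw [setIntegral_gaussianReal hs _ measurableSet_Iic]
  have hd (y : ℝ) : HasDerivAt (fun y => -(s * gaussianPDFReal m s y))
      (gaussianPDFReal m s y * (y - m)) y := by
    refine ((hasDerivAt_gaussianPDFReal m hs y).const_mul (s : ℝ)).neg.congr_deriv ?_
    field_simp
  have hi : Integrable fun y => gaussianPDFReal m s y * (y - m) :=
    (integrable_gaussianReal_iff hs).1
      ((integrable_fun_id_gaussianReal m s).sub (integrable_const m))
  have hl := tendsto_zero_of_hasDerivAt_of_integrableOn_Iic (a := x) (fun y _ => hd y)
    hi.integrableOn ((integrable_gaussianPDFReal m s).const_mul (s : ℝ)).neg.integrableOn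
  rw [integral_Iic_of_hasDerivAt_of_tendsto' (fun y _ => hd y) hi.integrableOn hl, sub_zero]

lemma hasDerivAt_integral_Iic {h : ℝ → ℝ} (hc : Continuous h) (hi : Integrable h) (x : ℝ) :
    HasDerivAt (fun x => ∫ y in Set.Iic x, h y) (h x) x := by
  have h1 := (hc.integral_hasStrictDerivAt 0 x).hasDerivAt.const_add (∫ y in Set.Iic 0, h y)
  refine h1.congr_of_eventuallyEq (Eventually.of_forall fun z => ?_)
  have := intervalIntegral.integral_Iic_sub_Iic (a := 0) (b := z) hi.integrableOn hi.integrableOn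
  simp only
  linarith

/-- Up to a positive factor, the left-hand side is the derivative at `x` of the solution of the
Stein equation for `f`. It is linear in `f` and vanishes for affine `f`, so that only the remainder of `f`
over its supporting line at `x` contributes. -/
lemma gaussian_stein_deriv_nonpos {m : ℝ} {s : ℝ≥0} (hs : s ≠ 0) {f : ℝ → ℝ}
    (hf : ConvexOn ℝ Set.univ f) (hi : Integrable f (gaussianReal m s)) (x : ℝ) :
    (x - m) * (∫ y in Set.Iic x, (f y - ∫ z, f z ∂gaussianReal m s) ∂gaussianReal m s) +
      s * gaussianPDFReal m s x * (f x - ∫ z, f z ∂gaussianReal m s) ≤ 0 := by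
  obtain ⟨k, hk⟩ := hf.exists_subgradient x
  set ν := gaussianReal m s
  set c := ∫ z, f z ∂ν with hc
  have hid : Integrable (fun y => y - m) ν :=
    (integrable_fun_id_gaussianReal m s).sub (integrable_const m)
  have hmean : ∫ y, (y - m) ∂ν = 0 := by
    rw [integral_sub (integrable_fun_id_gaussianReal m s) (integrable_const m),
      integral_id_gaussianReal]
    simp
  -- the remainder of `f` after subtracting its supporting line at `x`
  set r : ℝ → ℝ := fun y => f y - (f x + k * (y - x)) with hr
  have hr0 (y : ℝ) : 0 ≤ r y := sub_nonneg.2 (hk y)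
  have hrf (y : ℝ) : f y = r y + k * (y - m) + (f x + k * (m - x)) := by simp only [hr]; ring
  have hri : Integrable r ν := by
    have : r = fun y => f y - (k * (y - m) + (f x + k * (m - x))) := by
      ext y; simp only [hr]; ring
    rw [this]
    exact hi.sub ((hid.const_mul k).add (integrable_const _))
  have hA : 0 ≤ ∫ y in Set.Iic x, r y ∂ν := integral_nonneg hr0
  have hB : 0 ≤ ∫ y in Set.Ioi x, r y ∂ν := integral_nonneg hr0
  have hAB : ∫ y, r y ∂ν = ∫ y in Set.Iic x, r y ∂ν + ∫ y in Set.Ioi x, r y ∂ν := by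
    rw [← integral_add_compl measurableSet_Iic hri, Set.compl_Iic]
  have hcval : c = ∫ y in Set.Iic x, r y ∂ν + ∫ y in Set.Ioi x, r y ∂ν +
      (f x + k * (m - x)) := by
    rw [hc, ← hAB, integral_congr_ae (ae_of_all ν hrf),
      integral_add (f := fun y => r y + k * (y - m)) (hri.add (hid.const_mul k))
        (integrable_const _),
      integral_add hri (hid.const_mul k), integral_const_mul, hmean,
      integral_const, probReal_univ, one_smul, mul_zero, add_zero]
  have hM := setIntegral_Iic_gaussianReal_sub (m := m) hs x
  have hG : ∫ y in Set.Iic x, (f y - c) ∂ν = ∫ y in Set.Iic x, r y ∂ν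
      - k * (s * gaussianPDFReal m s x) + (f x + k * (m - x) - c) * ν.real (Set.Iic x) := by
    have (y : ℝ) : f y - c = r y + k * (y - m) + (f x + k * (m - x) - c) := by rw [hrf y]; ring
    simp_rw [this]
    rw [integral_add (f := fun y => r y + k * (y - m)) (hri.add (hid.const_mul k)).integrableOn
        (integrable_const _),
      integral_add hri.integrableOn (hid.const_mul k).integrableOn, integral_const_mul, hM,
      setIntegral_const, smul_eq_mul]
    ring
  -- `T = E (x - Y)⁺` and `T - (x - m) = E (Y - x)⁺`
  set T := (x - m) * ν.real (Set.Iic x) + s * gaussianPDFReal m s x with hT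
  have hT1 : ∫ y in Set.Iic x, (x - y) ∂ν = T := by
    have (y : ℝ) : x - y = (x - m) - (y - m) := by ring
    rw [integral_congr_ae (ae_of_all _ this), integral_sub (integrable_const _) hid.integrableOn,
      hM, setIntegral_const, smul_eq_mul, hT]
    ring
  have hT2 : ∫ y in Set.Ioi x, (y - x) ∂ν = T - (x - m) := by
    have h1 := integral_add_compl (μ := ν) (measurableSet_Iic (a := x))
      ((integrable_const x).sub (integrable_fun_id_gaussianReal m s))
    have h2 : ∫ y, (x - y) ∂ν = x - m := by
      rw [integral_sub (integrable_const x) (integrable_fun_id_gaussianReal m s),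
        integral_id_gaussianReal]
      simp
    simp only [Pi.sub_apply, Set.compl_Iic] at h1
    rw [h2, hT1] at h1
    have h3 : ∫ y in Set.Ioi x, (y - x) ∂ν = -∫ y in Set.Ioi x, (x - y) ∂ν := by
      rw [← integral_neg]; simp
    linarith
  have hT1' : 0 ≤ T := by
    rw [← hT1]
    exact setIntegral_nonneg measurableSet_Iic fun y hy => sub_nonneg.2 hy
  have hT2' : 0 ≤ T - (x - m) := by
    rw [← hT2]
    exact setIntegral_nonneg measurableSet_Ioi fun y hy => sub_nonneg.2 (le_of_lt hy)
  have key : (x - m) * (∫ y in Set.Iic x, (f y - c) ∂ν) + s * gaussianPDFReal m s x * (f x - c)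
      = -((∫ y in Set.Iic x, r y ∂ν) * (T - (x - m)) + (∫ y in Set.Ioi x, r y ∂ν) * T) := by
    rw [hG, hcval, hT]; ring
  rw [key]
  exact neg_nonpos.2 (add_nonneg (mul_nonneg hA hT2') (mul_nonneg hB hT1'))

/-- For convex `f`, the Gaussian Stein equation has a nonincreasing `C¹` solution. Only
`N(m, s)`-integrability of `f` is needed, no growth condition. -/
lemma exists_gaussian_stein_solution {m : ℝ} {s : ℝ≥0} (hs : s ≠ 0) {f : ℝ → ℝ}
    (hf : ConvexOn ℝ Set.univ f) (hi : Integrable f (gaussianReal m s)) :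
    ∃ g g' : ℝ → ℝ, (∀ x, HasDerivAt g (g' x) x) ∧ Continuous g' ∧ (∀ x, g' x ≤ 0) ∧
      ∀ x, s * g' x - (x - m) * g x = f x - ∫ y, f y ∂gaussianReal m s := by
  have hs' : (0 : ℝ) < s := by exact_mod_cast pos_iff_ne_zero.2 hs
  have hp (x : ℝ) := gaussianPDFReal_pos m s x hs
  have hfc := hf.continuous_of_univ
  set c := ∫ y, f y ∂gaussianReal m s
  set p := gaussianPDFReal m s
  have hpc : Continuous p := continuous_gaussianPDFReal m s
  have hGd := hasDerivAt_integral_Iic (h := fun y => p y * (f y - c)) (by fun_prop)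
    ((integrable_gaussianReal_iff hs).1 (hi.sub (integrable_const c)))
  set G : ℝ → ℝ := fun x => ∫ y in Set.Iic x, p y * (f y - c) with hG
  have hGc : Continuous G := continuous_iff_continuousAt.2 fun x => (hGd x).continuousAt
  refine ⟨fun x => G x / (s * p x),
    fun x => ((x - m) * G x + s * p x * (f x - c)) / (s ^ 2 * p x), fun x => ?_, ?_, fun x => ?_,
    fun x => ?_⟩
  · have hpx := (hp x).ne'
    refine ((hGd x).div ((hasDerivAt_gaussianPDFReal m hs x).const_mul (s : ℝ))
      (mul_pos hs' (hp x)).ne').congr_deriv ?_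
    change (p x * (f x - c) * (s * p x) - G x * (s * (-((x - m) / s) * p x))) / (s * p x) ^ 2 = _
    field_simp
    ring
  · exact (by fun_prop : Continuous fun x => (x - m) * G x + s * p x * (f x - c)).div
      (by fun_prop) fun x => (mul_pos (pow_pos hs' 2) (hp x)).ne'
  · refine div_nonpos_of_nonpos_of_nonneg ?_ (mul_pos (pow_pos hs' 2) (hp x)).le
    have := gaussian_stein_deriv_nonpos hs hf hi x
    rwa [setIntegral_gaussianReal hs _ measurableSet_Iic] at this
  · have hpx := (hp x).ne'
    field_simp
    ring

/-! ### Integration by parts for products of Gamma distributions -/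

lemma isProbabilityMeasure_gammaLaw {a : ℝ} (ha : 0 ≤ a) : IsProbabilityMeasure (gammaLaw a) := by
  unfold gammaLaw
  split_ifs with h
  · infer_instance
  · exact isProbabilityMeasure_gammaMeasure (lt_of_le_of_ne ha (Ne.symm h)) one_pos

lemma gammaMeasure_eq_withDensity_restrict (a : ℝ) :
    gammaMeasure a 1 = (volume.restrict (Set.Ioi 0)).withDensity
      fun x => ENNReal.ofReal ((Real.Gamma a)⁻¹ * (Real.exp (-x) * x ^ (a - 1))) := by
  rw [gammaMeasure, ← withDensity_indicator measurableSet_Ioi]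
  refine withDensity_congr_ae ?_
  filter_upwards [Measure.ae_ne volume (0 : ℝ)] with x hx
  rcases lt_or_gt_of_ne hx with h | h
  · rw [gammaPDF_of_neg h, Set.indicator_of_notMem (by simpa using h.le)]
  · rw [gammaPDF_of_nonneg h.le, Set.indicator_of_mem (by simpa using h)]
    simp only [Real.one_rpow, one_div, one_mul]
    congr 1; ring

lemma integral_gammaMeasure {a : ℝ} (ha : 0 < a) (h : ℝ → ℝ) :
    ∫ x, h x ∂gammaMeasure a 1 =
      (Real.Gamma a)⁻¹ * ∫ x in Set.Ioi 0, Real.exp (-x) * x ^ (a - 1) * h x := by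
  have hG := Real.Gamma_pos_of_pos ha
  rw [gammaMeasure_eq_withDensity_restrict,
    integral_withDensity_eq_integral_toReal_smul (by fun_prop) (ae_of_all _ fun _ => by simp),
    ← integral_const_mul]
  refine setIntegral_congr_fun measurableSet_Ioi fun x hx => ?_
  have hx' : 0 < x := hx
  simp only [smul_eq_mul]
  rw [ENNReal.toReal_ofReal (by positivity)]
  ring

lemma ae_gammaMeasure_pos (a : ℝ) : ∀ᵐ x ∂gammaMeasure a 1, 0 < x := by
  rw [gammaMeasure_eq_withDensity_restrict]
  exact (withDensity_absolutelyContinuous _ _).ae_le (ae_restrict_mem measurableSet_Ioi)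

lemma ae_gammaLaw_nonneg (a : ℝ) : ∀ᵐ x ∂gammaLaw a, 0 ≤ x := by
  unfold gammaLaw
  split_ifs with h
  · simp [ae_dirac_eq]
  · filter_upwards [ae_gammaMeasure_pos a] with x hx using hx.le

lemma ae_pi_gammaLaw_nonneg {S : ℕ} {α : Fin S → ℝ} (hα : ∀ i, 0 ≤ α i) :
    ∀ᵐ γ ∂(Measure.pi fun j => gammaLaw (α j)), ∀ j, 0 ≤ γ j := by
  have hprob := fun j => isProbabilityMeasure_gammaLaw (hα j)
  exact ae_all_iff.2 fun j => (Measure.tendsto_eval_ae_ae (i := j)).eventually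
    (ae_gammaLaw_nonneg (α j))

lemma integrable_id_gammaLaw {a : ℝ} (ha : 0 ≤ a) : Integrable (fun x => x) (gammaLaw a) := by
  unfold gammaLaw
  split_ifs with h
  · exact integrable_dirac (by simp)
  have ha' : 0 < a := lt_of_le_of_ne ha (Ne.symm h)
  have hG := Real.Gamma_pos_of_pos ha'
  rw [gammaMeasure_eq_withDensity_restrict, integrable_withDensity_iff_integrable_smul'
    (by fun_prop) (ae_of_all _ fun _ => by simp)]
  refine IntegrableOn.congr_fun
    ((Real.GammaIntegral_convergent (s := a + 1) (by linarith)).const_mul (Real.Gamma a)⁻¹)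
    (fun x hx => ?_) measurableSet_Ioi
  have hx' : 0 < x := hx
  simp only [smul_eq_mul]
  rw [ENNReal.toReal_ofReal (by positivity), add_sub_cancel_right, Real.rpow_sub_one hx'.ne']
  field_simp

/-- The Stein identity of the Gamma distribution: integration by parts against
`x ^ a * exp (-x)`, whose derivative is `(a - x) * x ^ (a - 1) * exp (-x)`. Nothing is assumed of
`F` at `0`; for `a = 0` both sides vanish because the law is the point mass at `0`. -/
lemma integral_gammaLaw_by_parts {a : ℝ} (ha : 0 ≤ a) {F F' : ℝ → ℝ} {C : ℝ}
    (hF : ∀ x, 0 < x → HasDerivAt F (F' x) x) (hb : ∀ x, 0 < x → |F x| ≤ C)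
    (hb' : ∀ x, 0 < x → |x * F' x| ≤ C) :
    ∫ x, (x - a) * F x ∂gammaLaw a = ∫ x, x * F' x ∂gammaLaw a := by
  unfold gammaLaw
  split_ifs with h
  · simp [h]
  have ha' : 0 < a := lt_of_le_of_ne ha (Ne.symm h)
  rw [integral_gammaMeasure ha', integral_gammaMeasure ha']
  congr 1
  have hFm : AEStronglyMeasurable F (volume.restrict (Set.Ioi 0)) :=
    ContinuousOn.aestronglyMeasurable
      (fun x hx => (hF x hx).continuousAt.continuousWithinAt) measurableSet_Ioi
  have hFm' : AEStronglyMeasurable (fun x => x * F' x) (volume.restrict (Set.Ioi 0)) := by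
    refine (measurable_id.mul (measurable_deriv F)).aestronglyMeasurable.congr ?_
    filter_upwards [ae_restrict_mem measurableSet_Ioi] with x hx
    simp [(hF x hx).deriv]
  have hI := Real.GammaIntegral_convergent ha'
  have hI' := Real.GammaIntegral_convergent (s := a + 1) (by linarith)
  rw [add_sub_cancel_right] at hI'
  have hd : ∀ x ∈ Set.Ioi (0 : ℝ), HasDerivAt (fun x : ℝ => Real.exp (-x) * x ^ a)
      (Real.exp (-x) * x ^ (a - 1) * (a - x)) x := by
    intro x hx
    have hx' : 0 < x := hx
    refine ((hasDerivAt_neg x).exp.mul (Real.hasDerivAt_rpow_const (Or.inl hx'.ne'))).congr_deriv ?_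
    rw [Real.rpow_sub_one hx'.ne']
    field_simp
    ring
  have hu : IntegrableOn (fun x : ℝ => Real.exp (-x) * x ^ (a - 1) * (a - x) * F x)
      (Set.Ioi 0) := by
    have h1 : IntegrableOn (fun x : ℝ => Real.exp (-x) * x ^ (a - 1) * (a - x)) (Set.Ioi 0) := by
      refine IntegrableOn.congr_fun ((hI.const_mul a).sub hI') (fun x hx => ?_) measurableSet_Ioi
      have hx' : 0 < x := hx
      simp only [Pi.sub_apply]
      rw [Real.rpow_sub_one hx'.ne']
      field_simp
    refine h1.mul_bdd (c := C) hFm ?_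
    filter_upwards [ae_restrict_mem measurableSet_Ioi] with x hx using hb x hx
  have hv : IntegrableOn (fun x : ℝ => Real.exp (-x) * x ^ a * F' x) (Set.Ioi 0) := by
    refine IntegrableOn.congr_fun (f := fun x => Real.exp (-x) * x ^ (a - 1) * (x * F' x))
      (hI.mul_bdd (c := C) hFm' ?_) (fun x hx => ?_) measurableSet_Ioi
    · filter_upwards [ae_restrict_mem measurableSet_Ioi] with x hx using hb' x hx
    · have hx' : 0 < x := hx
      simp only
      rw [Real.rpow_sub_one hx'.ne']
      field_simp
  -- a function that tends to `0` along `l`, times the bounded `F`, tends to `0` along `l`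
  have hlim {l : Filter ℝ} (hl : ∀ᶠ x in l, 0 < x)
      (ht : Tendsto (fun x : ℝ => Real.exp (-x) * x ^ a) l (𝓝 0)) :
      Tendsto ((fun x : ℝ => Real.exp (-x) * x ^ a) * F) l (𝓝 0) := by
    refine ht.zero_mul_isBoundedUnder_le ⟨C, ?_⟩
    rw [eventually_map]
    filter_upwards [hl] with x hx using hb x hx
  have h0 : Tendsto (fun x : ℝ => Real.exp (-x) * x ^ a) (𝓝[>] 0) (𝓝 0) := by
    have : ContinuousAt (fun x : ℝ => Real.exp (-x) * x ^ a) 0 :=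
      (by fun_prop : ContinuousAt (fun x : ℝ => Real.exp (-x)) 0).mul
        (Real.continuousAt_rpow_const 0 a (Or.inr ha))
    have h2 := this.tendsto
    simp only [Real.zero_rpow ha'.ne', mul_zero] at h2
    exact h2.mono_left nhdsWithin_le_nhds
  have hinf : Tendsto (fun x : ℝ => Real.exp (-x) * x ^ a) atTop (𝓝 0) := by
    refine (tendsto_rpow_mul_exp_neg_mul_atTop_nhds_zero a 1 one_pos).congr fun x => ?_
    rw [neg_one_mul, mul_comm]
  have key := integral_Ioi_deriv_mul_eq_sub (v := F) (v' := F') hd hF (hu.add hv)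
    (hlim self_mem_nhdsWithin h0) (hlim (eventually_gt_atTop 0) hinf)
  rw [integral_add hu hv, sub_zero] at key
  have e1 : ∫ x in Set.Ioi (0 : ℝ), Real.exp (-x) * x ^ (a - 1) * ((x - a) * F x) =
      -∫ x in Set.Ioi (0 : ℝ), Real.exp (-x) * x ^ (a - 1) * (a - x) * F x := by
    rw [← integral_neg]
    congr 1 with x
    ring
  have e2 : ∫ x in Set.Ioi (0 : ℝ), Real.exp (-x) * x ^ (a - 1) * (x * F' x) =
      ∫ x in Set.Ioi (0 : ℝ), Real.exp (-x) * x ^ a * F' x := by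
    refine setIntegral_congr_fun measurableSet_Ioi fun x hx => ?_
    have hx' : 0 < x := hx
    rw [Real.rpow_sub_one hx'.ne']
    field_simp
  rw [e1, e2]
  linarith

/-- Gamma integration by parts in the coordinate `i` of independent Gamma variables, the other
coordinates being held fixed by Fubini; `Ψ` is the partial derivative of `Φ`. -/
lemma integral_pi_gammaLaw_by_parts {S : ℕ} {α : Fin S → ℝ} (hα : ∀ i, 0 ≤ α i) (i : Fin S)
    {Φ Ψ : (Fin S → ℝ) → ℝ} {C : ℝ} (hΦ : Measurable Φ) (hΨ : Measurable Ψ)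
    (hd : ∀ γ : Fin S → ℝ, (∀ j, 0 ≤ γ j) → 0 < γ i →
      HasDerivAt (fun x => Φ (Function.update γ i x)) (Ψ γ) (γ i))
    (hb : ∀ γ : Fin S → ℝ, (∀ j, 0 ≤ γ j) → |Φ γ| ≤ C)
    (hb' : ∀ γ : Fin S → ℝ, (∀ j, 0 ≤ γ j) → |γ i * Ψ γ| ≤ C) :
    Integrable (fun γ => (γ i - α i) * Φ γ) (Measure.pi fun j => gammaLaw (α j)) ∧
    Integrable (fun γ => γ i * Ψ γ) (Measure.pi fun j => gammaLaw (α j)) ∧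
    ∫ γ, (γ i - α i) * Φ γ ∂(Measure.pi fun j => gammaLaw (α j)) =
      ∫ γ, γ i * Ψ γ ∂(Measure.pi fun j => gammaLaw (α j)) := by
  have hprob := fun j => isProbabilityMeasure_gammaLaw (hα j)
  have hnn := ae_pi_gammaLaw_nonneg hα
  have hcoord : Integrable (fun γ : Fin S → ℝ => γ i) (Measure.pi fun j => gammaLaw (α j)) :=
    (measurePreserving_eval (fun j => gammaLaw (α j)) i).integrable_comp_of_integrable
      (integrable_id_gammaLaw (hα i))
  have hI1 : Integrable (fun γ => (γ i - α i) * Φ γ) (Measure.pi fun j => gammaLaw (α j)) :=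
    (hcoord.sub (integrable_const _)).mul_bdd (c := C) hΦ.aestronglyMeasurable
      (hnn.mono fun γ hγ => hb γ hγ)
  have hI2 : Integrable (fun γ => γ i * Ψ γ) (Measure.pi fun j => gammaLaw (α j)) :=
    Integrable.of_bound (by fun_prop) C (hnn.mono fun γ hγ => hb' γ hγ)
  refine ⟨hI1, hI2, ?_⟩
  obtain _ | n := S
  · exact i.elim0
  have he := (measurePreserving_piFinSuccAbove (fun j => gammaLaw (α j)) i).symm
  rw [← he.integral_comp', ← he.integral_comp',
    integral_prod_symm (fun z => _ * _) (he.integrable_comp_of_integrable hI1),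
    integral_prod_symm (fun z => _ * _) (he.integrable_comp_of_integrable hI2)]
  refine integral_congr_ae ?_
  filter_upwards [ae_pi_gammaLaw_nonneg fun j => hα (i.succAbove j)] with q hq
  have hins (x : ℝ) (hx : 0 < x) (j : Fin (n + 1)) :
      0 ≤ Fin.insertNth (α := fun _ => ℝ) i x q j := by
    rcases Fin.eq_self_or_eq_succAbove i j with rfl | ⟨k, rfl⟩
    · simpa using hx.le
    · simpa using hq k
  have := integral_gammaLaw_by_parts (hα i) (C := C)
    (F := fun x => Φ (Fin.insertNth (α := fun _ => ℝ) i x q))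
    (F' := fun x => Ψ (Fin.insertNth (α := fun _ => ℝ) i x q))
    (fun x hx => by simpa using hd _ (hins x hx) (by simpa using hx))
    (fun x hx => hb _ (hins x hx)) (fun x hx => by simpa using hb' _ (hins x hx))
  simpa [MeasurableEquiv.piFinSuccAbove_symm_apply, Fin.insertNthEquiv] using this

/-! ### The weighted average under Dirichlet weights -/

/-- The average of `v` with weights proportional to `γ`; it is `0` if the weights sum to `0`. -/
noncomputable def weightedAverage {S : ℕ} (v γ : Fin S → ℝ) : ℝ :=
  (∑ j, γ j * v j) / ∑ j, γ j

/-- The variance of `v` under the weights `γ i / ∑ j, γ j`; it is `0` if the `γ j` sum to `0`. -/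
noncomputable def weightedVariance {S : ℕ} (v γ : Fin S → ℝ) : ℝ :=
  ∑ i, γ i / (∑ j, γ j) * (v i - weightedAverage v γ) ^ 2

section

variable {S : ℕ} {v : Fin S → ℝ}

lemma measurable_weightedAverage (v : Fin S → ℝ) : Measurable (weightedAverage v) := by
  unfold weightedAverage; fun_prop

lemma measurable_weightedVariance (v : Fin S → ℝ) : Measurable (weightedVariance v) := by
  have := measurable_weightedAverage v
  unfold weightedVariance; fun_prop

lemma weightedAverage_mem_Icc (hv : ∀ i, v i ∈ Set.Icc (0 : ℝ) 1) {γ : Fin S → ℝ}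
    (hγ : ∀ j, 0 ≤ γ j) : weightedAverage v γ ∈ Set.Icc (0 : ℝ) 1 := by
  refine ⟨div_nonneg (Finset.sum_nonneg fun j _ => mul_nonneg (hγ j) (hv j).1)
    (Finset.sum_nonneg fun j _ => hγ j), div_le_one_of_le₀ (Finset.sum_le_sum fun j _ => ?_)
    (Finset.sum_nonneg fun j _ => hγ j)⟩
  exact mul_le_of_le_one_right (hγ j) (hv j).2

lemma abs_sub_weightedAverage_le_one (hv : ∀ i, v i ∈ Set.Icc (0 : ℝ) 1) {γ : Fin S → ℝ}
    (hγ : ∀ j, 0 ≤ γ j) (i : Fin S) : |v i - weightedAverage v γ| ≤ 1 := by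
  have h := weightedAverage_mem_Icc hv hγ
  rw [abs_le]
  constructor <;> linarith [h.1, h.2, (hv i).1, (hv i).2]

lemma div_sum_mem_Icc {γ : Fin S → ℝ} (hγ : ∀ j, 0 ≤ γ j) (i : Fin S) :
    γ i / ∑ j, γ j ∈ Set.Icc (0 : ℝ) 1 :=
  ⟨div_nonneg (hγ i) (Finset.sum_nonneg fun j _ => hγ j),
    div_le_one_of_le₀ (Finset.single_le_sum (fun j _ => hγ j) (Finset.mem_univ i))
      (Finset.sum_nonneg fun j _ => hγ j)⟩

lemma weightedVariance_mem_Icc (hv : ∀ i, v i ∈ Set.Icc (0 : ℝ) 1) {γ : Fin S → ℝ}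
    (hγ : ∀ j, 0 ≤ γ j) : weightedVariance v γ ∈ Set.Icc (0 : ℝ) 1 := by
  refine ⟨Finset.sum_nonneg fun i _ => mul_nonneg (div_sum_mem_Icc hγ i).1 (sq_nonneg _), ?_⟩
  calc weightedVariance v γ ≤ ∑ i, γ i / ∑ j, γ j := Finset.sum_le_sum fun i _ =>
        mul_le_of_le_one_right (div_sum_mem_Icc hγ i).1
          ((sq_le_one_iff_abs_le_one _).2 (abs_sub_weightedAverage_le_one hv hγ i))
    _ ≤ 1 := by rw [← Finset.sum_div]; exact div_self_le_one _

/-- Deviations from the weighted average cancel. If the weights sum to `0`, then they all vanish,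
and the value `0` of the average does no harm. -/
lemma sum_mul_sub_weightedAverage {γ : Fin S → ℝ} (hγ : ∀ j, 0 ≤ γ j) :
    ∑ i, γ i * (v i - weightedAverage v γ) = 0 := by
  simp_rw [mul_sub]
  rw [Finset.sum_sub_distrib, ← Finset.sum_mul, weightedAverage]
  rcases eq_or_ne (∑ j, γ j) 0 with h | h
  · have h0 := (Finset.sum_eq_zero_iff_of_nonneg fun j _ => hγ j).1 h
    have h1 : ∑ j, γ j * v j = 0 := Finset.sum_eq_zero fun j hj => by rw [h0 j hj, zero_mul]
    simp [h, h1]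
  · rw [mul_div_cancel₀ _ h, sub_self]

lemma hasDerivAt_weightedAverage_update (v : Fin S → ℝ) (i : Fin S) {γ : Fin S → ℝ}
    (hγ : ∑ j, γ j ≠ 0) :
    HasDerivAt (fun x => weightedAverage v (Function.update γ i x))
      ((v i - weightedAverage v γ) / ∑ j, γ j) (γ i) := by
  have hu := hasDerivAt_pi.1 (hasDerivAt_update γ i (γ i))
  have hs : HasDerivAt (fun x => ∑ j, Function.update γ i x j) 1 (γ i) :=
    (HasDerivAt.fun_sum fun j _ => hu j).congr_deriv (by simp)
  have hn : HasDerivAt (fun x => ∑ j, Function.update γ i x j * v j) (v i) (γ i) :=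
    (HasDerivAt.fun_sum fun j _ => (hu j).mul_const (v j)).congr_deriv (by simp [Pi.single_apply])
  refine (hn.fun_div hs (by simpa using hγ)).congr_deriv ?_
  simp only [Function.update_eq_self, weightedAverage]
  field_simp

/-- The Stein identity of `X = weightedAverage v γ` for independent Gamma variables `γ`: its Stein
kernel is `weightedVariance v γ / ∑ i, α i`. -/
lemma dirichlet_stein_identity {α : Fin S → ℝ} (hα : ∀ i, 0 ≤ α i)
    (hα0 : ∑ i, α i ≠ 0) (hv : ∀ i, v i ∈ Set.Icc (0 : ℝ) 1)
    {g g' : ℝ → ℝ} (hg : ∀ x, HasDerivAt g (g' x) x) (hg' : Continuous g') :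
    ∫ γ, (∑ i, α i) * ((weightedAverage v γ - (∑ i, α i * v i) / ∑ i, α i) *
        g (weightedAverage v γ)) ∂(Measure.pi fun j => gammaLaw (α j)) =
      ∫ γ, weightedVariance v γ * g' (weightedAverage v γ)
        ∂(Measure.pi fun j => gammaLaw (α j)) := by
  have hgc : Continuous g := continuous_iff_continuousAt.2 fun x => (hg x).continuousAt
  have hRm := measurable_weightedAverage v
  obtain ⟨A, hA⟩ := (isCompact_Icc (a := (0 : ℝ)) (b := 1)).exists_bound_of_continuousOn
    hgc.continuousOn
  obtain ⟨B, hB⟩ := (isCompact_Icc (a := (0 : ℝ)) (b := 1)).exists_bound_of_continuousOn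
    hg'.continuousOn
  simp only [Real.norm_eq_abs] at hA hB
  have hB0 : 0 ≤ B := (abs_nonneg _).trans (hB 0 (by simp))
  have hnn := ae_pi_gammaLaw_nonneg hα
  -- for this `Φ`, both sums over `i` collapse by `sum_mul_sub_weightedAverage`
  have key (i : Fin S) := integral_pi_gammaLaw_by_parts hα i (C := A + B)
    (Φ := fun γ => (v i - weightedAverage v γ) * g (weightedAverage v γ))
    (Ψ := fun γ => (v i - weightedAverage v γ) / (∑ j, γ j) *
      ((v i - weightedAverage v γ) * g' (weightedAverage v γ) - g (weightedAverage v γ)))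
    (by fun_prop) (by fun_prop)
    (fun γ hγ hi => by
      have hs : ∑ j, γ j ≠ 0 :=
        (hi.trans_le (Finset.single_le_sum (fun j _ => hγ j) (Finset.mem_univ i))).ne'
      have hR := hasDerivAt_weightedAverage_update v i hs
      have hgR := (hg (weightedAverage v (Function.update γ i (γ i)))).comp (γ i) hR
      refine ((hR.const_sub (v i)).mul hgR).congr_deriv ?_
      simp only [Function.comp, Function.update_eq_self]
      ring)
    (fun γ hγ => by
      have h1 := abs_sub_weightedAverage_le_one hv hγ i
      have h2 := hA _ (weightedAverage_mem_Icc hv hγ)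
      rw [abs_mul]
      calc _ ≤ 1 * A := mul_le_mul h1 h2 (abs_nonneg _) zero_le_one
        _ ≤ A + B := by linarith)
    (fun γ hγ => by
      have h1 := abs_sub_weightedAverage_le_one hv hγ i
      have h2 := hA _ (weightedAverage_mem_Icc hv hγ)
      have h3 := hB _ (weightedAverage_mem_Icc hv hγ)
      have h4 := div_sum_mem_Icc hγ i
      have h5 : |(v i - weightedAverage v γ) * g' (weightedAverage v γ) -
          g (weightedAverage v γ)| ≤ A + B := by
        refine (abs_sub _ _).trans ?_
        rw [abs_mul]
        have := mul_le_mul h1 h3 (abs_nonneg _) zero_le_one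
        linarith
      calc _ = (γ i / ∑ j, γ j) * |v i - weightedAverage v γ| *
            |(v i - weightedAverage v γ) * g' (weightedAverage v γ) - g (weightedAverage v γ)| := by
            rw [← abs_of_nonneg h4.1, ← abs_mul, ← abs_mul]
            congr 1
            ring
        _ ≤ 1 * (A + B) := mul_le_mul
            (mul_le_one₀ h4.2 (abs_nonneg _) h1) h5 (abs_nonneg _) zero_le_one
        _ = A + B := one_mul _)
  have hsum := Finset.sum_congr (rfl : Finset.univ = (Finset.univ : Finset (Fin S)))
    fun i _ => (key i).2.2
  rw [← integral_finsetSum _ fun i _ => (key i).1,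
    ← integral_finsetSum _ fun i _ => (key i).2.1] at hsum
  refine Eq.trans (integral_congr_ae ?_) (hsum.trans (integral_congr_ae ?_))
  · filter_upwards [hnn] with γ hγ
    have h0 := sum_mul_sub_weightedAverage (v := v) hγ
    set R := weightedAverage v γ
    have : ∑ i, (γ i - α i) * ((v i - R) * g R) =
        ((∑ i, γ i * (v i - R)) - ((∑ i, α i * v i) - (∑ i, α i) * R)) * g R := by
      rw [Finset.sum_mul, ← Finset.sum_sub_distrib, ← Finset.sum_sub_distrib, Finset.sum_mul]
      exact Finset.sum_congr rfl fun i _ => by ring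
    rw [this, h0]
    field_simp
    ring
  · filter_upwards [hnn] with γ hγ
    have h0 := sum_mul_sub_weightedAverage (v := v) hγ
    have : ∑ i, γ i * ((v i - weightedAverage v γ) / (∑ j, γ j) *
        ((v i - weightedAverage v γ) * g' (weightedAverage v γ) - g (weightedAverage v γ))) =
        weightedVariance v γ * g' (weightedAverage v γ) -
        (∑ i, γ i * (v i - weightedAverage v γ)) * (g (weightedAverage v γ) / ∑ j, γ j) := by
      rw [weightedVariance, Finset.sum_mul, Finset.sum_mul, ← Finset.sum_sub_distrib]
      exact Finset.sum_congr rfl fun i _ => by ring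
    rw [this, h0, zero_mul, sub_zero]

lemma hasLaw_dotProduct_dirichletMeasure {Ω : Type*} [MeasurableSpace Ω] {μ : Measure Ω}
    {α : Fin S → ℝ} {P : Ω → Fin S → ℝ} (hP : HasLaw P (dirichletMeasure α) μ) (v : Fin S → ℝ) :
    HasLaw (fun ω => P ω ⬝ᵥ v)
      ((Measure.pi fun j => gammaLaw (α j)).map (weightedAverage v)) μ := by
  have hm : Measurable fun p : Fin S → ℝ => p ⬝ᵥ v := by unfold dotProduct; fun_prop
  refine HasLaw.fun_comp (Y := fun p => p ⬝ᵥ v) ⟨hm.aemeasurable, ?_⟩ hP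
  rw [dirichletMeasure, Measure.map_map hm (by fun_prop)]
  congr 1
  ext γ
  simp [dotProduct, weightedAverage, Finset.sum_div, div_mul_eq_mul_div]

lemma ae_weightedAverage_mem_Icc {α : Fin S → ℝ} (hα : ∀ i, 0 ≤ α i)
    (hv : ∀ i, v i ∈ Set.Icc (0 : ℝ) 1) :
    ∀ᵐ x ∂(Measure.pi fun j => gammaLaw (α j)).map (weightedAverage v),
      x ∈ Set.Icc (0 : ℝ) 1 := by
  refine (ae_map_iff (measurable_weightedAverage v).aemeasurable
    (measurableSet_Icc (a := (0 : ℝ)) (b := 1))).2 ?_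
  filter_upwards [ae_pi_gammaLaw_nonneg hα] with γ hγ using weightedAverage_mem_Icc hv hγ

lemma Continuous.integrable_weightedAverage {f : ℝ → ℝ} (hf : Continuous f) {α : Fin S → ℝ}
    (hα : ∀ i, 0 ≤ α i) (hv : ∀ i, v i ∈ Set.Icc (0 : ℝ) 1) :
    Integrable f ((Measure.pi fun j => gammaLaw (α j)).map (weightedAverage v)) := by
  have hprob := fun j => isProbabilityMeasure_gammaLaw (hα j)
  have := Measure.isProbabilityMeasure_map
    (μ := Measure.pi fun j => gammaLaw (α j)) (measurable_weightedAverage v).aemeasurable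
  obtain ⟨A, hA⟩ := (isCompact_Icc (a := (0 : ℝ)) (b := 1)).exists_bound_of_continuousOn
    hf.continuousOn
  exact Integrable.of_bound hf.aestronglyMeasurable A
    ((ae_weightedAverage_mem_Icc hα hv).mono hA)

lemma integral_id_weightedAverage {α : Fin S → ℝ} (hα : ∀ i, 0 ≤ α i) (hα0 : ∑ i, α i ≠ 0)
    (hv : ∀ i, v i ∈ Set.Icc (0 : ℝ) 1) :
    ∫ x, x ∂(Measure.pi fun j => gammaLaw (α j)).map (weightedAverage v) =
      (∑ i, α i * v i) / ∑ i, α i := by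
  have hprob := fun j => isProbabilityMeasure_gammaLaw (hα j)
  have hRm := measurable_weightedAverage v
  -- the Stein identity for the constant function `1` says that the mean is the one claimed
  have h := dirichlet_stein_identity hα hα0 hv (g := fun _ => 1) (g' := fun _ => 0)
    (fun x => hasDerivAt_const x 1) continuous_const
  simp only [mul_one, mul_zero, integral_zero] at h
  have hi : Integrable (weightedAverage v) (Measure.pi fun j => gammaLaw (α j)) :=
    (continuous_id.integrable_weightedAverage hα hv).comp_measurable hRm
  rw [integral_const_mul, mul_eq_zero, or_iff_right hα0, integral_sub hi (integrable_const _),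
    integral_const, probReal_univ, one_smul, sub_eq_zero] at h
  rw [integral_map hRm.aemeasurable (by fun_prop), h]

/-- The average of `v` under Dirichlet weights is smaller, in the convex order, than the Gaussian
distribution with the same mean and with variance `1 / ∑ i, α i`. -/
lemma ConvexOn.integral_weightedAverage_le_gaussianReal {f : ℝ → ℝ}
    (hf : ConvexOn ℝ Set.univ f) {α : Fin S → ℝ} (hα : ∀ i, 0 ≤ α i) (hα0 : 0 < ∑ i, α i)
    (hv : ∀ i, v i ∈ Set.Icc (0 : ℝ) 1)
    (hi : Integrable f (gaussianReal ((∑ i, α i * v i) / ∑ i, α i) (∑ i, α i)⁻¹.toNNReal)) :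
    ∫ x, f x ∂(Measure.pi fun j => gammaLaw (α j)).map (weightedAverage v) ≤
      ∫ x, f x ∂gaussianReal ((∑ i, α i * v i) / ∑ i, α i) (∑ i, α i)⁻¹.toNNReal := by
  have hprob := fun j => isProbabilityMeasure_gammaLaw (hα j)
  have hRm := measurable_weightedAverage v
  set n := ∑ i, α i
  set m := (∑ i, α i * v i) / n
  set π := Measure.pi fun j => gammaLaw (α j)
  have hs : n⁻¹.toNNReal ≠ 0 := by simpa using hα0
  obtain ⟨g, g', hg, hg'c, hg'0, hstein⟩ := exists_gaussian_stein_solution hs hf hi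
  set c := ∫ x, f x ∂gaussianReal m n⁻¹.toNNReal
  rw [Real.coe_toNNReal _ (inv_pos.2 hα0).le] at hstein
  have hgc : Continuous g := continuous_iff_continuousAt.2 fun x => (hg x).continuousAt
  have hfc := hf.continuous_of_univ
  have hint {h : ℝ → ℝ} (hh : Continuous h) : Integrable (fun γ => h (weightedAverage v γ)) π :=
    (hh.integrable_weightedAverage hα hv).comp_measurable hRm
  have hid := dirichlet_stein_identity hα hα0.ne' hv hg hg'c
  rw [integral_map hRm.aemeasurable (by fun_prop)]
  have h1 : ∫ γ, f (weightedAverage v γ) ∂π - c =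
      ∫ γ, n⁻¹ * g' (weightedAverage v γ) ∂π -
        ∫ γ, (weightedAverage v γ - m) * g (weightedAverage v γ) ∂π := by
    rw [← integral_sub (hint (h := fun x => n⁻¹ * g' x) (by fun_prop))
      (hint (h := fun x => (x - m) * g x) (by fun_prop))]
    simp_rw [hstein]
    rw [integral_sub (hint hfc) (integrable_const _), integral_const, probReal_univ, one_smul]
  have h2 : ∫ γ, g' (weightedAverage v γ) ∂π ≤
      ∫ γ, weightedVariance v γ * g' (weightedAverage v γ) ∂π := by
    have hV := ae_pi_gammaLaw_nonneg hα
    refine integral_mono_ae (hint hg'c) ((hint hg'c).bdd_mul (c := 1)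
      (measurable_weightedVariance v).aestronglyMeasurable (hV.mono fun γ hγ => ?_))
      (hV.mono fun γ hγ => ?_)
    · have := weightedVariance_mem_Icc hv hγ
      rw [Real.norm_of_nonneg this.1]
      exact this.2
    · have := weightedVariance_mem_Icc hv hγ
      change g' (weightedAverage v γ) ≤ weightedVariance v γ * g' (weightedAverage v γ)
      nlinarith [this.2, hg'0 (weightedAverage v γ)]
  rw [integral_const_mul] at hid h1
  rw [← hid] at h2
  have h3 := mul_le_mul_of_nonneg_left h2 (inv_pos.2 hα0).le
  rw [inv_mul_cancel_left₀ hα0.ne'] at h3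
  linarith

end

/-! ### Expectations in the extended reals -/

lemma extendedExpectation_eq_integral {Ω : Type*} [MeasurableSpace Ω] {μ : Measure Ω} {Z : Ω → ℝ}
    (hZ : Integrable Z μ) : extendedExpectation μ Z = ((∫ ω, Z ω ∂μ : ℝ) : EReal) := by
  rw [extendedExpectation, integral_eq_lintegral_pos_part_sub_lintegral_neg_part hZ, EReal.coe_sub,
    EReal.coe_ennreal_toReal hZ.lintegral_lt_top.ne,
    EReal.coe_ennreal_toReal (by simpa using hZ.neg.lintegral_lt_top.ne)]

lemma extendedExpectation_eq_bot {Ω : Type*} [MeasurableSpace Ω] {μ : Measure Ω} {Z W : Ω → ℝ}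
    (hZm : AEStronglyMeasurable Z μ) (hZ : ¬ Integrable Z μ) (hW : Integrable W μ)
    (hZW : ∀ ω, Z ω ≤ W ω) : extendedExpectation μ Z = ⊥ := by
  have hpos : ∫⁻ ω, ENNReal.ofReal (Z ω) ∂μ ≠ ⊤ :=
    ((lintegral_mono fun ω => ENNReal.ofReal_le_ofReal (hZW ω)).trans_lt
      hW.lintegral_lt_top).ne
  have hneg : ∫⁻ ω, ENNReal.ofReal (-Z ω) ∂μ = ⊤ := by
    by_contra hne
    refine hZ ⟨hZm, ?_⟩
    rw [hasFiniteIntegral_iff_norm]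
    have (ω : Ω) : ENNReal.ofReal ‖Z ω‖ ≤ ENNReal.ofReal (Z ω) + ENNReal.ofReal (-Z ω) := by
      rw [Real.norm_eq_abs]
      rcases abs_cases (Z ω) with h | h <;> rw [h.1]
      exacts [le_self_add, le_add_self]
    refine (lintegral_mono this).trans_lt ?_
    rw [lintegral_add_left' (by fun_prop)]
    exact ENNReal.add_lt_top.2 ⟨hpos.lt_top, lt_top_iff_ne_top.2 hne⟩
  rw [extendedExpectation, hneg, EReal.coe_ennreal_top, sub_eq_add_neg, EReal.neg_top,
    EReal.add_bot]

/-! ### Second-order stochastic dominance -/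

theorem theorem1 {Ω : Type*} [MeasurableSpace Ω] (μ : Measure Ω) [IsProbabilityMeasure μ]
    {S : ℕ} (α v : Fin S → ℝ)
    (hα : ∀ i, 0 ≤ α i) (hα2 : 2 ≤ ∑ i, α i)
    (hv : ∀ i, v i ∈ Set.Icc (0 : ℝ) 1)
    (P : Ω → Fin S → ℝ) (hP : HasLaw P (dirichletMeasure α) μ)
    (X : Ω → ℝ) (hX : ∀ ω, X ω = P ω ⬝ᵥ v)
    (Y : Ω → ℝ)
    (hY : HasLaw Y
      (gaussianReal ((∑ i, α i * v i) / ∑ i, α i) (Real.toNNReal (∑ i, α i)⁻¹)) μ) :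
    Integrable X μ ∧ Integrable Y μ ∧ ∫ ω, X ω ∂μ = ∫ ω, Y ω ∂μ ∧
      SecondOrderDominates μ X Y := by
  have hn : 0 < ∑ i, α i := by linarith
  have hXlaw := hasLaw_dotProduct_dirichletMeasure hP v
  rw [← funext hX] at hXlaw
  have hintX {h : ℝ → ℝ} (hh : Continuous h) : Integrable (fun ω => h (X ω)) μ := by
    have := hh.integrable_weightedAverage hα hv
    rw [← hXlaw.map_eq] at this
    exact this.comp_aemeasurable hXlaw.aemeasurable
  have hintY {h : ℝ → ℝ} (hh : Continuous h) : Integrable (fun ω => h (Y ω)) μ ↔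
      Integrable h (gaussianReal ((∑ i, α i * v i) / ∑ i, α i) (∑ i, α i)⁻¹.toNNReal) := by
    rw [← hY.map_eq]
    exact (integrable_map_measure hh.aestronglyMeasurable hY.aemeasurable).symm
  have hYi : Integrable Y μ := (hintY continuous_id).2 (integrable_fun_id_gaussianReal _ _)
  refine ⟨hintX continuous_id, hYi, ?_, fun u hu _ => ?_⟩
  · rw [hXlaw.integral_eq, hY.integral_eq, integral_id_gaussianReal,
      integral_id_weightedAverage hα hn.ne' hv]
  have huc : Continuous u := by simpa using hu.neg.continuous_of_univ.neg
  by_cases huY : Integrable (fun ω => u (Y ω)) μ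
  · rw [extendedExpectation_eq_integral huY, extendedExpectation_eq_integral (hintX huc),
      EReal.coe_le_coe_iff]
    have h := hu.neg.integral_weightedAverage_le_gaussianReal hα hn hv ((hintY huc).1 huY).neg
    simp only [Pi.neg_apply, integral_neg, neg_le_neg_iff] at h
    rw [← hXlaw.integral_comp huc.aestronglyMeasurable,
      ← hY.integral_comp huc.aestronglyMeasurable] at h
    exact h
  -- the supporting line of `-u` at `0` bounds `u` above by an integrable function of `Y`
  · obtain ⟨k, hk⟩ := hu.neg.exists_subgradient 0
    rw [extendedExpectation_eq_bot (W := fun ω => u 0 - k * Y ω)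
      (huc.comp_aestronglyMeasurable hYi.aestronglyMeasurable) huY
      ((integrable_const _).sub (hYi.const_mul k)) fun ω => ?_]
    · exact bot_le
    · have := hk (Y ω)
      simp only [Pi.neg_apply, sub_zero] at this
      linarith
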